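/- Let $X$ be a complex Banach space and $B(X)$ the algebra of bounded linear operators on $X$ with the operator norm. For $A\in B(X)$ let $\Delta_A$ be the bounded operator on the Banach space $B(X)$ given by $\Delta_A(T)=AT-TA$. For a bounded operator $S$ on a complex Banach space $Y$ and $y\in Y$, the local spectrum $\sigma_S(y)$ is the complement in $\mathbb{C}$ of the set of all $\lambda$ for which there are an open neighbourhood $U$ of $\lambda$ and an analytic function $u:U\to Y$ with $(zI-S)u(z)=y$ for all $z\in U$. The local spectral radius is $r_S(y)=\sup\{|\lambda|:\lambda\in\sigma_S(y)\}$, with $\sup\emptyset=0$. The operator $S$ has the single-valued extension property (SVEP) if, for every open $U\subseteq\mathbb{C}$, the only analytic $u:U\to Y$ with $(zI-S)u(z)=0$ for all $z\in U$ is $u\equiv 0$. **Corollary.** Let $A\in B(X)$ be such that $\Delta_A$ has SVEP, and let $0\le\alpha<1$. If $T\in B(X)$ and $C_T>0$ satisfy $$\|e^{tA}Te^{-tA}\|\le C_T\,(1+|t|^{\alpha})\qquad\text{for all }t\in\mathbb{R},$$ then $$\|AT-TA\|\le C_T\left[r_{\Delta_A}(T)+C(\alpha)\,r_{\Delta_A}(T)^{1-\alpha}\right],\qquad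 C(\alpha)=\left(\frac{2}{\pi}\right)^{2-\alpha}\sum_{k\in\mathbb{Z}}\frac{1}{|2k+1|^{2-\alpha}}.$$ Here $|t|^0=1$ for every $t$, including $t=0$. -/

import Mathlib

noncomputable section

namespace LocalSpectral

variable {X : Type*} [NormedAddCommGroup X] [NormedSpace ℂ X]

/-- The local resolvent set `ρ_T(x)` of a bounded operator `T` at `x`: the set of all `z₀ : ℂ`
which have an open neighbourhood `U` carrying an analytic function `u` with values in `X` such
that `(z I - T) u(z) = x` for all `z ∈ U`. -/
def localResolventSet (T : X →L[ℂ] X) (x : X) : Set ℂ :=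
  {z₀ | ∃ U : Set ℂ, IsOpen U ∧ z₀ ∈ U ∧ ∃ u : ℂ → X, AnalyticOnNhd ℂ u U ∧
    ∀ z ∈ U, z • u z - T (u z) = x}

/-- The local spectrum `σ_T(x)`: the complement of the local resolvent set. -/
def localSpectrum (T : X →L[ℂ] X) (x : X) : Set ℂ :=
  (localResolventSet T x)ᶜ

/-- The local spectral radius `r_T(x) = sup {|z| : z ∈ σ_T(x)}`. On a Banach space the set is
bounded (`bddAbove_norm_localSpectrum`); the supremum of the empty set is `0`. -/
def localSpectralRadius (T : X →L[ℂ] X) (x : X) : ℝ :=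
  sSup ((fun z : ℂ => ‖z‖) '' localSpectrum T x)

/-- The single-valued extension property: for every open `U ⊆ ℂ`, the only analytic `u : U → X`
with `(z I - T) u(z) = 0` on `U` is `u ≡ 0`. -/
def HasSVEP (T : X →L[ℂ] X) : Prop :=
  ∀ U : Set ℂ, IsOpen U → ∀ u : ℂ → X, AnalyticOnNhd ℂ u U →
    (∀ z ∈ U, z • u z - T (u z) = 0) → ∀ z ∈ U, u z = 0

/-- The inner derivation `Δ_A : T ↦ A T - T A`, as a bounded operator on the Banach space
`B(X)` of bounded operators with the operator norm. -/
def innerDerivation (A : X →L[ℂ] X) : (X →L[ℂ] X) →L[ℂ] (X →L[ℂ] X) :=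
  ContinuousLinearMap.mul ℂ (X →L[ℂ] X) A - (ContinuousLinearMap.mul ℂ (X →L[ℂ] X)).flip A

theorem innerDerivation_apply (A T : X →L[ℂ] X) : innerDerivation A T = A * T - T * A := rfl

/-- The constant `C(α) = (2/π)^(2-α) ∑_{k ∈ ℤ} 1 / |2k+1|^(2-α)`. -/
def commutatorConst (α : ℝ) : ℝ :=
  (2 / Real.pi) ^ (2 - α) * ∑' k : ℤ, 1 / |2 * (k : ℝ) + 1| ^ (2 - α)

/-- The series in `commutatorConst` converges for `α < 1`. -/
theorem summable_commutatorConst {α : ℝ} (hα : α < 1) :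
    Summable fun k : ℤ => 1 / |2 * (k : ℝ) + 1| ^ (2 - α) := by
  have h := (Real.summable_abs_int_rpow (b := 2 - α) (by linarith)).comp_injective
    (i := fun k : ℤ => 2 * k + 1) (fun a b h => by simpa using h)
  refine h.congr fun k => ?_
  rw [one_div, ← Real.rpow_neg (abs_nonneg _)]
  simp [Function.comp]

theorem localSpectrum_subset_spectrum [CompleteSpace X] (T : X →L[ℂ] X) (x : X) :
    localSpectrum T x ⊆ spectrum ℂ T := by
  intro z hz
  by_contra hn
  refine hz ⟨resolventSet ℂ T, spectrum.isOpen_resolventSet T, ?_, fun w => resolvent T w x, ?_, ?_⟩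
  · simpa [spectrum] using hn
  · refine DifferentiableOn.analyticOnNhd (fun w hw => ?_) (spectrum.isOpen_resolventSet T)
    exact (((spectrum.hasDerivAt_resolvent_const_left hw).differentiableAt).clm_apply
      (differentiableAt_const x)).differentiableWithinAt
  · intro w hw
    have h : (algebraMap ℂ (X →L[ℂ] X) w - T) * resolvent T w = 1 :=
      Ring.mul_inverse_cancel _ hw
    have := congrArg (fun S : X →L[ℂ] X => S x) h
    simpa [Algebra.algebraMap_eq_smul_one] using this

theorem bddAbove_norm_localSpectrum [CompleteSpace X] (T : X →L[ℂ] X) (x : X) :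
    BddAbove ((fun z : ℂ => ‖z‖) '' localSpectrum T x) :=
  ((spectrum.isCompact T).image continuous_norm).bddAbove.mono
    (Set.image_mono (localSpectrum_subset_spectrum T x))

end LocalSpectral

end

/-! Put `f z = exp (z A) T exp (-z A)` and let `Δ` be the inner derivation. Then `f' = Δ f`, so `f`
is entire with Taylor coefficients `Δ^n T / n!`, and the goal is a bound for `f' 0`.

Local spectral theory gives the exponential type of `f`. For `ρ` above the local spectral radius
`r`, SVEP glues the local solutions of the resolvent equation into one analytic function near
infinity. In the variable `w = 1/z` its Taylor coefficients are `Δ^n T`, and Cauchy's estimate gives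
`‖Δ^n T‖ ≤ M ρ^n` (`HasSVEP.exists_norm_pow_apply_le`). Hence `‖f z‖ ≤ M exp (ρ |z|)`.

The rest is a Bernstein inequality (`norm_deriv_zero_le_commutatorConst`). After scaling to type 1,
Phragmén–Lindelöf improves the bound to `K (1 + |z|)^α exp |im z|`. Integrating `(f z - cos z • f 0)
/ (z² cos z)` over circles of radius `Nπ` expresses `f' 0` through the values of `f` at the zeros
`x_k` of the cosine, with weights of modulus `1 / x_k²`. Inserting `C (1 + ρ^(-α) |x_k|^α)` gives
the two sums `1` and `C(α)`. Finally `ρ` decreases to `r`. -/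

namespace LocalSpectral

open Filter Topology Metric

/-! ### Residues at simple poles -/

/-- The residue theorem on a disc for a function with finitely many simple poles. -/
theorem circleIntegral_eq_sum_of_simple_poles {E : Type*} [NormedAddCommGroup E]
    [NormedSpace ℂ E] [CompleteSpace E] {F : ℂ → E} {S : Finset ℂ} {R : ℝ} {res : ℂ → E}
    (hR : 0 < R) (hS : ∀ a ∈ S, a ∈ ball (0 : ℂ) R)
    (hd : ∀ z ∈ closedBall (0 : ℂ) R, z ∉ S → DifferentiableAt ℂ F z)
    (hres : ∀ a ∈ S, Tendsto (fun z => (z - a) • F z) (𝓝[≠] a) (𝓝 (res a))) :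
    ∮ z in C(0, R), F z = (2 * Real.pi * Complex.I : ℂ) • ∑ a ∈ S, res a := by
  set G : ℂ → E := fun z => F z - ∑ a ∈ S, (z - a)⁻¹ • res a with hG
  have hGd : ∀ z ∈ closedBall (0 : ℂ) R, z ∉ S → DifferentiableAt ℂ G z := by
    intro z hz hzS
    refine (hd z hz hzS).sub ?_
    refine DifferentiableAt.fun_sum fun a ha => ?_
    refine DifferentiableAt.smul_const ?_ _
    refine DifferentiableAt.inv (by fun_prop) ?_
    exact sub_ne_zero.2 fun h => hzS (h ▸ ha)
  -- `G` is `F` without its principal parts; taking punctured limits fills in its removable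
  -- singularities.
  set H : ℂ → E := fun z => limUnder (𝓝[≠] z) G with hH
  have hHG : ∀ z, ContinuousAt G z → H z = G z := fun z hz =>
    (hz.tendsto.mono_left nhdsWithin_le_nhds).limUnder_eq
  have hSc : IsClosed (S : Set ℂ) := S.finite_toSet.isClosed
  have hHd : ∀ z ∈ ball (0 : ℂ) R, DifferentiableAt ℂ H z := by
    intro z hz
    by_cases hzS : z ∈ S
    · have hU : ball (0 : ℂ) R ∩ ((S.erase z : Finset ℂ) : Set ℂ)ᶜ ∈ 𝓝 z := by
        refine inter_mem (isOpen_ball.mem_nhds hz) ?_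
        exact (S.erase z).finite_toSet.isClosed.isOpen_compl.mem_nhds (by simp)
      have hdU : DifferentiableOn ℂ G ((ball (0 : ℂ) R ∩ ((S.erase z : Finset ℂ) : Set ℂ)ᶜ) \ {z}) := by
        rintro w ⟨⟨hw1, hw2⟩, hw3⟩
        refine (hGd w (ball_subset_closedBall hw1) fun h => hw2 ?_).differentiableWithinAt
        exact Finset.mem_coe.2 (Finset.mem_erase.2 ⟨hw3, h⟩)
      have hlim : Tendsto (fun w => (w - z) • (G w - G z)) (𝓝[≠] z) (𝓝 0) := by
        have h1 := hres z hzS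
        have h2 : Tendsto (fun w : ℂ => (w - z) • (∑ a ∈ S.erase z, (w - a)⁻¹ • res a + G z))
            (𝓝[≠] z) (𝓝 0) := by
          have : ContinuousAt
              (fun w : ℂ => (w - z) • (∑ a ∈ S.erase z, (w - a)⁻¹ • res a + G z)) z := by
            refine ContinuousAt.smul (by fun_prop) (ContinuousAt.add ?_ continuousAt_const)
            refine tendsto_finsetSum _ fun a ha => ?_
            refine Tendsto.smul_const (ContinuousAt.tendsto ?_) _
            refine ContinuousAt.inv₀ (by fun_prop) ?_
            exact sub_ne_zero.2 (Finset.ne_of_mem_erase ha).symm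
          have h := this.tendsto.mono_left (nhdsWithin_le_nhds (s := {z}ᶜ))
          simpa using h
        have h3 := (h1.sub h2).sub_const (res z)
        simp only [sub_zero, sub_self] at h3
        refine h3.congr' ?_
        filter_upwards [self_mem_nhdsWithin] with w hw
        have hw' : w - z ≠ 0 := sub_ne_zero.2 hw
        have : G w = F w - ((w - z)⁻¹ • res z + ∑ a ∈ S.erase z, (w - a)⁻¹ • res a) := by
          rw [hG, Finset.add_sum_erase S (fun a => (w - a)⁻¹ • res a) hzS]
        rw [this]
        simp only [smul_sub, smul_add, smul_inv_smul₀ hw']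
        abel
      have ho : (fun w => G w - G z) =o[𝓝[≠] z] fun w => (w - z)⁻¹ := by
        rw [← Asymptotics.isLittleO_norm_norm]
        rw [Asymptotics.isLittleO_iff_tendsto']
        · refine (tendsto_zero_iff_norm_tendsto_zero.1 hlim).congr fun w => ?_
          rw [norm_smul, norm_inv, div_inv_eq_mul, mul_comm]
        · filter_upwards [self_mem_nhdsWithin] with w hw h
          have hw' : w - z ≠ 0 := sub_ne_zero.2 hw
          simp [hw'] at h
      have hup := Complex.differentiableOn_update_limUnder_of_isLittleO hU hdU ho
      refine (hup.differentiableAt hU).congr_of_eventuallyEq ?_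
      filter_upwards [hU] with w hw
      by_cases hwz : w = z
      · subst hwz; simp [hH]
      · rw [Function.update_of_ne hwz]
        exact hHG w ((hdU.differentiableAt (by
          have : IsOpen ((ball (0 : ℂ) R ∩ ((S.erase z : Finset ℂ) : Set ℂ)ᶜ) \ {z}) :=
            (isOpen_ball.inter (S.erase z).finite_toSet.isClosed.isOpen_compl).sdiff
              isClosed_singleton
          exact this.mem_nhds ⟨hw, hwz⟩)).continuousAt)
    · refine (hGd z (ball_subset_closedBall hz) hzS).congr_of_eventuallyEq ?_
      filter_upwards [isOpen_ball.mem_nhds hz, hSc.isOpen_compl.mem_nhds hzS] with w hw hwS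
      exact hHG w (hGd w (ball_subset_closedBall hw) hwS).continuousAt
  have hsphere : ∀ z ∈ sphere (0 : ℂ) R, z ∉ S := fun z hz h => by
    have := hS z h
    simp only [mem_sphere_iff_norm, mem_ball_iff_norm] at this hz
    linarith
  have hHc : ContinuousOn H (closedBall 0 R) := by
    intro z hz
    by_cases hzb : z ∈ ball (0 : ℂ) R
    · exact (hHd z hzb).continuousAt.continuousWithinAt
    · have hzs : z ∈ sphere (0 : ℂ) R := by
        simp only [mem_sphere_iff_norm, mem_ball_iff_norm, mem_closedBall_iff_norm] at *
        linarith
      have hzS := hsphere z hzs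
      refine (hGd z hz hzS).continuousAt.continuousWithinAt.congr_of_eventuallyEq ?_
        (hHG z (hGd z hz hzS).continuousAt)
      filter_upwards [self_mem_nhdsWithin,
        nhdsWithin_le_nhds (hSc.isOpen_compl.mem_nhds hzS)] with w hw hwS
      exact hHG w (hGd w hw hwS).continuousAt
  have hzero : ∮ z in C(0, R), H z = 0 :=
    Complex.circleIntegral_eq_zero_of_differentiable_on_off_countable hR.le Set.countable_empty hHc
      fun z hz => hHd z hz.1
  have hFc : CircleIntegrable F 0 R := by
    refine ContinuousOn.circleIntegrable hR.le fun z hz => ?_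
    exact (hd z (sphere_subset_closedBall hz) (hsphere z hz)).continuousAt.continuousWithinAt
  have hPc : ∀ a ∈ S, CircleIntegrable (fun z : ℂ => (z - a)⁻¹ • res a) 0 R := by
    intro a ha
    refine ContinuousOn.circleIntegrable hR.le fun z hz => ContinuousAt.continuousWithinAt ?_
    refine ContinuousAt.smul (ContinuousAt.inv₀ (by fun_prop) ?_) continuousAt_const
    exact sub_ne_zero.2 fun h => hsphere z hz (h ▸ ha)
  have hHG' : ∮ z in C(0, R), H z = ∮ z in C(0, R), G z :=
    circleIntegral.integral_congr hR.le fun z hz =>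
      hHG z (hGd z (sphere_subset_closedBall hz) (hsphere z hz)).continuousAt
  rw [hHG', hG, circleIntegral.integral_sub hFc (CircleIntegrable.fun_sum S hPc), circleIntegral.integral_fun_sum hPc,
    sub_eq_zero] at hzero
  rw [hzero, Finset.smul_sum]
  refine Finset.sum_congr rfl fun a ha => ?_
  rw [circleIntegral.integral_smul_const, circleIntegral.integral_sub_inv_of_mem_ball (hS a ha)]

/-! ### Lower bound for the cosine on circles -/

theorem norm_sq_cos (z : ℂ) : ‖Complex.cos z‖ ^ 2 = Real.cos z.re ^ 2 + Real.sinh z.im ^ 2 := by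
  rw [Complex.sq_norm, Complex.normSq_apply]
  conv_lhs => rw [← Complex.re_add_im z, Complex.cos_add_mul_I]
  simp only [← Complex.ofReal_cos, ← Complex.ofReal_cosh, ← Complex.ofReal_sin,
    ← Complex.ofReal_sinh, Complex.sub_re, Complex.sub_im, Complex.mul_re, Complex.mul_im,
    Complex.ofReal_re, Complex.ofReal_im, Complex.I_re, Complex.I_im]
  have h1 := Real.cosh_sq z.im
  have h2 := Real.sin_sq_add_cos_sq z.re
  ring_nf
  rw [h1, show Real.sin z.re ^ 2 = 1 - Real.cos z.re ^ 2 by linarith]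
  ring

/-- These circles cross the real axis at `±Nπ`, where the cosine has modulus 1, midway between
consecutive zeros. -/
theorem exp_abs_le_norm_cos {z : ℂ} {N : ℕ} (hN : 1 ≤ N) (hz : ‖z‖ = N * Real.pi) :
    Real.exp |z.im| / 4 ≤ ‖Complex.cos z‖ := by
  have key := norm_sq_cos z
  rw [← sq_le_sq₀ (by positivity) (norm_nonneg _), key]
  rcases le_total 1 |z.im| with hy | hy
  · have h1 : Real.sinh z.im ^ 2 = Real.sinh |z.im| ^ 2 := by
      rcases abs_choice z.im with h | h <;> rw [h]
      rw [Real.sinh_neg, neg_sq]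
    have h2 : Real.exp |z.im| / 4 ≤ Real.sinh |z.im| := by
      have h3 : 2 ≤ Real.exp |z.im| := by linarith [Real.add_one_le_exp |z.im|]
      have h4 : Real.exp (-|z.im|) ≤ 1 := Real.exp_le_one_iff.2 (by simp)
      rw [Real.sinh_eq]
      linarith
    rw [h1]
    have := pow_le_pow_left₀ (by positivity) h2 2
    nlinarith [sq_nonneg (Real.cos z.re)]
  -- Near the real axis the circle stays close to `±R`: the distance `d = R - |re z|` satisfies `d
  -- (R + |re z|) = (im z)² ≤ 1`, so `d ≤ 1/3` and `cos d ≥ 1 - d²/2 ≥ 17/18 > e/4`.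
  · set R : ℝ := N * Real.pi with hR
    have hR3 : 3 ≤ R := by
      have h1 : (1 : ℝ) ≤ N := by exact_mod_cast hN
      nlinarith [Real.pi_gt_three]
    have hsq : R ^ 2 = z.re ^ 2 + z.im ^ 2 := by
      rw [← hz, Complex.sq_norm, Complex.normSq_apply]; ring
    have hxR : |z.re| ≤ R := hz ▸ Complex.abs_re_le_norm z
    set d := R - |z.re| with hd
    have hd0 : 0 ≤ d := by linarith
    have hy1 : z.im ^ 2 ≤ 1 := by
      rw [← sq_abs]; exact pow_le_one₀ (abs_nonneg _) hy
    have hdd : d * (R + |z.re|) = z.im ^ 2 := by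
      rw [hd]; linear_combination hsq - sq_abs z.re
    have hd3 : d ≤ 1 / 3 := by
      nlinarith [abs_nonneg z.re, mul_nonneg hd0 (abs_nonneg z.re), mul_le_mul_of_nonneg_left hR3 hd0]
    have hcos : Real.cos z.re ^ 2 = Real.cos d ^ 2 := by
      rw [← Real.cos_abs z.re, show |z.re| = N * Real.pi - d by rw [hd]; ring,
        Real.cos_nat_mul_pi_sub, mul_pow, ← pow_mul, mul_comm N 2, pow_mul]
      simp
    have hcd : 17 / 18 ≤ Real.cos d := by
      nlinarith [Real.one_sub_sq_div_two_le_cos (x := d)]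
    have he : Real.exp |z.im| ≤ 2.7182818286 :=
      (Real.exp_le_exp.2 hy).trans Real.exp_one_lt_d9.le
    rw [hcos]
    have h5 : Real.exp |z.im| / 4 ≤ 17 / 18 := by linarith
    have h6 := pow_le_pow_left₀ (by positivity) (h5.trans hcd) 2
    nlinarith [sq_nonneg (Real.sinh z.im)]

/-! ### Growth off the real axis -/

/-- Phragmén–Lindelöf bound in the upper half plane. -/
theorem norm_le_of_im_nonneg {E : Type*} [NormedAddCommGroup E] [NormedSpace ℂ E]
    {f : ℂ → E} (hf : Differentiable ℂ f) {M K α : ℝ} (hα : 0 ≤ α)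
    (hM : ∀ z, ‖f z‖ ≤ M * Real.exp ‖z‖)
    (hK : ∀ t : ℝ, ‖f t‖ ≤ K * ‖(1 - Complex.I * t : ℂ)‖ ^ α) {z : ℂ} (hz : 0 ≤ z.im) :
    ‖f z‖ ≤ K * (1 + ‖z‖) ^ α * Real.exp |z.im| := by
  have hM0 : 0 ≤ M := by simpa using (norm_nonneg _).trans (hM 0)
  have hK0 : 0 ≤ K := by simpa using (norm_nonneg _).trans (hK 0)
  -- The rotation `w ↦ I * w` maps the right half plane to the upper one. The factor `exp (-w)`
  -- cancels the exponential type, and `(1 + w)^α` the growth on the boundary.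
  set g : ℂ → E := fun w => (Complex.exp (-w) / (1 + w) ^ (α : ℂ)) • f (Complex.I * w) with hg
  have hbig : ∀ w : ℂ, 0 ≤ w.re → 1 ≤ ‖1 + w‖ := fun w hw => by
    refine le_trans ?_ (Complex.re_le_norm _)
    simpa using hw
  have hgn : ∀ w : ℂ, ‖g w‖ = Real.exp (-w.re) / ‖1 + w‖ ^ α * ‖f (Complex.I * w)‖ := by
    intro w
    rw [hg, norm_smul, norm_div, Complex.norm_exp, Complex.norm_cpow_real, Complex.neg_re]
  have hgle : ∀ w : ℂ, 0 ≤ w.re → ‖g w‖ ≤ M * Real.exp (‖w‖ - w.re) := by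
    intro w hw
    rw [hgn]
    have h1 : 1 ≤ ‖1 + w‖ ^ α := Real.one_le_rpow (hbig w hw) hα
    calc _ ≤ Real.exp (-w.re) / 1 * (M * Real.exp ‖w‖) := by
          gcongr
          simpa using hM (Complex.I * w)
      _ = _ := by rw [sub_eq_add_neg, Real.exp_add]; ring
  have hgd : DiffContOnCl ℂ g {z | 0 < z.re} := by
    have : ∀ w : ℂ, 0 ≤ w.re → DifferentiableAt ℂ g w := by
      intro w hw
      have hs : 1 + w ∈ Complex.slitPlane := Or.inl (by simp; linarith)
      refine DifferentiableAt.smul (DifferentiableAt.div (by fun_prop) ?_ ?_) (by fun_prop)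
      · exact DifferentiableAt.cpow (by fun_prop) (by fun_prop) hs
      · rw [Ne, Complex.cpow_eq_zero_iff]
        intro h; rw [h.1] at hs; simp at hs
    refine DifferentiableOn.diffContOnCl fun w hw => (this w ?_).differentiableWithinAt
    rw [Complex.closure_setOfPred_lt_re] at hw
    exact hw
  have hgK : ∀ w : ℂ, 0 ≤ w.re → ‖g w‖ ≤ K := by
    intro w hw
    -- Order one is critical for a half plane, so boundedness on the positive real axis is needed
    -- too; there `‖w‖ - w.re = 0` and `g` is bounded by `M`.
    refine PhragmenLindelof.right_half_plane_of_bounded_on_real hgd ⟨1, by norm_num, 1, ?_⟩ ?_ ?_ hw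
    · refine Asymptotics.IsBigO.of_bound M ?_
      refine eventually_inf_principal.2 (Eventually.of_forall fun w hw => ?_)
      refine (hgle w (le_of_lt hw)).trans ?_
      rw [Real.norm_of_nonneg (Real.exp_pos _).le, Real.rpow_one, one_mul]
      have : 0 < w.re := hw
      gcongr; linarith
    · refine ⟨M, eventually_map.2 ?_⟩
      filter_upwards [eventually_ge_atTop (0 : ℝ)] with x hx
      refine (hgle x (by simpa using hx)).trans ?_
      simp [abs_of_nonneg hx]
    · intro x
      rw [hgn]
      have h1 : 0 < ‖(1 + x * Complex.I : ℂ)‖ ^ α :=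
        Real.rpow_pos_of_pos (lt_of_lt_of_le one_pos (hbig _ (by simp))) _
      have h2 := hK (-x)
      have e1 : Complex.I * (x * Complex.I) = ((-x : ℝ) : ℂ) := by
        push_cast
        linear_combination (x : ℂ) * Complex.I_mul_I
      have e2 : (1 - Complex.I * ((-x : ℝ) : ℂ)) = 1 + x * Complex.I := by push_cast; ring
      rw [e2] at h2
      rw [e1]
      simp only [Complex.mul_re, Complex.ofReal_re, Complex.I_re, mul_zero, Complex.ofReal_im,
        Complex.I_im, mul_one, sub_self, neg_zero, Real.exp_zero]
      rw [div_mul_eq_mul_div, one_mul]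
      exact (div_le_iff₀ h1).2 h2
  have h := hgK (-Complex.I * z) (by simpa using hz)
  rw [hgn] at h
  have e1 : Complex.I * (-Complex.I * z) = z := by
    linear_combination (-z) * Complex.I_mul_I
  have h0 : 1 ≤ ‖1 + -Complex.I * z‖ := hbig _ (by simpa using hz)
  have h1 : 0 < ‖1 + -Complex.I * z‖ ^ α := Real.rpow_pos_of_pos (one_pos.trans_le h0) _
  have e2 : (-Complex.I * z).re = z.im := by simp
  rw [e1, e2, div_mul_eq_mul_div, div_le_iff₀ h1, Real.exp_neg, ← div_eq_inv_mul,
    div_le_iff₀ (Real.exp_pos _)] at h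
  rw [abs_of_nonneg hz]
  refine h.trans ?_
  gcongr
  refine (norm_add_le _ _).trans ?_
  simp

theorem norm_le_mul_exp_abs_im {E : Type*} [NormedAddCommGroup E] [NormedSpace ℂ E]
    {f : ℂ → E} (hf : Differentiable ℂ f) {M K α : ℝ} (hα : 0 ≤ α)
    (hM : ∀ z, ‖f z‖ ≤ M * Real.exp ‖z‖)
    (hK : ∀ t : ℝ, ‖f t‖ ≤ K * ‖(1 - Complex.I * t : ℂ)‖ ^ α) (z : ℂ) :
    ‖f z‖ ≤ K * (1 + ‖z‖) ^ α * Real.exp |z.im| := by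
  rcases le_total 0 z.im with hz | hz
  · exact norm_le_of_im_nonneg hf hα hM hK hz
  · have h := norm_le_of_im_nonneg (f := fun z => f (-z)) (K := K) (hf.comp differentiable_neg) hα
      (fun z => by simpa using hM (-z)) (fun t => ?_) (z := -z) (by simpa using hz)
    · simpa using h
    · have := hK (-t)
      have e : ‖(1 - Complex.I * ((-t : ℝ) : ℂ))‖ = ‖(1 - Complex.I * t : ℂ)‖ := by
        rw [← Complex.norm_conj]
        simp [sub_eq_add_neg]
      rw [e] at this
      simpa using this

/-! ### Riesz interpolation at the zeros of the cosine -/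

/-- The zero `(2k + 1)π/2` of the cosine. -/
noncomputable def cosZero (k : ℤ) : ℝ := (2 * k + 1) * Real.pi / 2

theorem cosZero_ne_zero (k : ℤ) : cosZero k ≠ 0 := by
  have h : (2 * k + 1 : ℝ) ≠ 0 := by
    intro h
    have : (2 * k + 1 : ℤ) = 0 := by exact_mod_cast h
    omega
  have := Real.pi_ne_zero
  unfold cosZero
  positivity

theorem cosZero_injective : Function.Injective cosZero := fun a b h => by
  have hpi := Real.pi_ne_zero
  unfold cosZero at h
  field_simp at h
  have h' : (2 * a + 1 : ℤ) = 2 * b + 1 := by exact_mod_cast h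
  omega

theorem cos_cosZero (k : ℤ) : Complex.cos (cosZero k) = 0 :=
  Complex.cos_eq_zero_iff.2 ⟨k, by simp [cosZero]⟩

theorem norm_sin_cosZero (k : ℤ) : ‖Complex.sin (cosZero k)‖ = 1 := by
  have h := Complex.sin_sq_add_cos_sq (cosZero k : ℂ)
  rw [cos_cosZero] at h
  have h2 : ‖Complex.sin (cosZero k)‖ ^ 2 = 1 := by
    rw [← norm_pow]
    simpa using congrArg norm h
  exact (pow_eq_one_iff_of_nonneg (norm_nonneg _) two_ne_zero).1 h2

theorem abs_cosZero_lt_iff {N : ℕ} {k : ℤ} :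
    |cosZero k| < N * Real.pi ↔ k ∈ Finset.Ico (-N : ℤ) N := by
  have hpi := Real.pi_pos
  rw [abs_lt, Finset.mem_Ico]
  unfold cosZero
  constructor
  · rintro ⟨h1, h2⟩
    have h1' : (-(2 * N) : ℝ) < 2 * k + 1 := by nlinarith
    have h2' : (2 * k + 1 : ℝ) < 2 * N := by nlinarith
    have h1'' : -(2 * N : ℤ) < 2 * k + 1 := by exact_mod_cast h1'
    have h2'' : 2 * k + 1 < (2 * N : ℤ) := by exact_mod_cast h2'
    omega
  · rintro ⟨h1, h2⟩
    have h1' : -(2 * N : ℤ) < 2 * k + 1 := by omega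
    have h2' : 2 * k + 1 < (2 * N : ℤ) := by omega
    have h1'' : (-(2 * N) : ℝ) < 2 * k + 1 := by exact_mod_cast h1'
    have h2'' : (2 * k + 1 : ℝ) < 2 * N := by exact_mod_cast h2'
    constructor <;> nlinarith

theorem abs_cosZero_ne {N : ℕ} {k : ℤ} : |cosZero k| ≠ N * Real.pi := by
  intro h
  have hpi := Real.pi_pos
  have key : |(2 * k + 1 : ℤ)| = 2 * N := by
    have h1 : |cosZero k| = |(2 * k + 1 : ℝ)| * (Real.pi / 2) := by
      unfold cosZero
      rw [mul_div_assoc, abs_mul, abs_of_pos (by positivity : 0 < Real.pi / 2)]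
    have h2 : |(2 * k + 1 : ℝ)| = 2 * N := by
      rw [h1] at h
      have : (|(2 * k + 1 : ℝ)| - 2 * N) * (Real.pi / 2) = 0 := by linear_combination h
      rcases mul_eq_zero.1 this with h | h
      · linarith
      · exact absurd h (by positivity)
    exact_mod_cast h2
  rcases abs_choice (2 * k + 1 : ℤ) with h | h <;> omega

/-- Riesz interpolation on the disc of radius `Nπ`, with the contribution of its boundary. -/
theorem norm_deriv_zero_le_finset_sum {E : Type*} [NormedAddCommGroup E] [NormedSpace ℂ E]
    [CompleteSpace E] {f : ℂ → E} (hf : Differentiable ℂ f) {K α : ℝ} (hK0 : 0 ≤ K)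
    (hK : ∀ z, ‖f z‖ ≤ K * (1 + ‖z‖) ^ α * Real.exp |z.im|) {N : ℕ} (hN : 1 ≤ N) :
    ‖deriv f 0‖ ≤ ∑ k ∈ Finset.Ico (-N : ℤ) N, ‖f (cosZero k)‖ / cosZero k ^ 2 +
      (4 * K * (1 + N * Real.pi) ^ α + ‖f 0‖) / (N * Real.pi) := by
  set R : ℝ := N * Real.pi with hRdef
  have hN' : (1 : ℝ) ≤ N := by exact_mod_cast hN
  have hR : 0 < R := by positivity
  -- Subtracting `cos z • f 0` makes `q 0 = 0` without changing the values at the zeros of the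
  -- cosine. So `p = q / z` is entire with `p 0 = f' 0`, and `p / (z cos z)` has only simple poles.
  set q : ℂ → E := fun z => f z - Complex.cos z • f 0 with hq
  have hqd : Differentiable ℂ q := hf.sub (Complex.differentiable_cos.smul_const _)
  set p : ℂ → E := dslope q 0 with hp
  have hpd : Differentiable ℂ p := by
    rw [← differentiableOn_univ, hp, Complex.differentiableOn_dslope univ_mem]
    exact hqd.differentiableOn
  have hq0 : q 0 = 0 := by simp [hq]
  have hp0 : p 0 = deriv f 0 := by
    rw [hp, dslope_same]
    have h1 : HasDerivAt q (deriv f 0 - (-Complex.sin 0) • f 0) 0 :=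
      (hf 0).hasDerivAt.sub ((Complex.hasDerivAt_cos 0).smul_const _)
    simpa using h1.deriv
  have hpne : ∀ z, z ≠ 0 → p z = z⁻¹ • q z := fun z hz => by
    rw [hp, dslope_of_ne _ hz, slope_def_module, hq0]; simp
  set F : ℂ → E := fun z => (z * Complex.cos z)⁻¹ • p z with hF
  set S : Finset ℂ :=
    insert 0 ((Finset.Ico (-N : ℤ) N).image fun k => (cosZero k : ℂ)) with hSdef
  have h0S : (0 : ℂ) ∉ (Finset.Ico (-N : ℤ) N).image fun k => (cosZero k : ℂ) := by
    intro h
    obtain ⟨k, -, hk⟩ := Finset.mem_image.1 h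
    exact cosZero_ne_zero k (by exact_mod_cast hk)
  have hS : ∀ a ∈ S, a ∈ ball (0 : ℂ) R := by
    intro a ha
    rcases Finset.mem_insert.1 ha with rfl | ha
    · simpa using hR
    · obtain ⟨k, hk, rfl⟩ := Finset.mem_image.1 ha
      rw [mem_ball_zero_iff, Complex.norm_real, Real.norm_eq_abs]
      exact abs_cosZero_lt_iff.2 hk
  have hd : ∀ z ∈ closedBall (0 : ℂ) R, z ∉ S → DifferentiableAt ℂ F z := by
    intro z hz hzS
    have hz0 : z ≠ 0 := fun h => hzS (by simp [hSdef, h])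
    have hc : Complex.cos z ≠ 0 := by
      intro h
      obtain ⟨k, hk⟩ := Complex.cos_eq_zero_iff.1 h
      have hk' : z = (cosZero k : ℂ) := by rw [hk]; simp [cosZero]
      rw [hk', mem_closedBall_zero_iff, Complex.norm_real, Real.norm_eq_abs] at hz
      refine hzS (Finset.mem_insert_of_mem (Finset.mem_image.2 ⟨k, ?_, hk'.symm⟩))
      exact abs_cosZero_lt_iff.1 (lt_of_le_of_ne hz abs_cosZero_ne)
    refine DifferentiableAt.smul (DifferentiableAt.inv ?_ (mul_ne_zero hz0 hc)) (hpd z)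
    exact differentiableAt_id.mul Complex.differentiable_cos.differentiableAt
  -- The residue of `p / h` at a simple zero of `h` is `p a / h' a`, here with `h z = z cos z`.
  set res : ℂ → E := fun a => (Complex.cos a - a * Complex.sin a)⁻¹ • p a with hres
  have hsin : ∀ k, Complex.sin (cosZero k) ≠ 0 := fun k h => by
    have := norm_sin_cosZero k
    simp [h] at this
  have hderiv : ∀ a : ℂ, HasDerivAt (fun z => z * Complex.cos z)
      (Complex.cos a - a * Complex.sin a) a := fun a => by
    have := (hasDerivAt_id a).mul (Complex.hasDerivAt_cos a)
    refine this.congr_deriv ?_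
    simp; ring
  have hlim : ∀ a ∈ S, Tendsto (fun z => (z - a) • F z) (𝓝[≠] a) (𝓝 (res a)) := by
    intro a ha
    have hza : a * Complex.cos a = 0 ∧ Complex.cos a - a * Complex.sin a ≠ 0 := by
      rcases Finset.mem_insert.1 ha with rfl | ha
      · simp
      · obtain ⟨k, hk, rfl⟩ := Finset.mem_image.1 ha
        simp [cos_cosZero, hsin, cosZero_ne_zero]
    have h1 := (hasDerivAt_iff_tendsto_slope.1 (hderiv a)).inv₀ hza.2
    have h2 := h1.smul ((hpd a).continuousAt.tendsto.mono_left (nhdsWithin_le_nhds (s := {a}ᶜ)))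
    refine h2.congr fun z => ?_
    rw [slope_def_field, hza.1, sub_zero, inv_div, hF, div_eq_mul_inv, mul_smul]
  have hint := circleIntegral_eq_sum_of_simple_poles hR hS hd hlim
  have hbound : ‖∮ z in C(0, R), F z‖ ≤
      2 * Real.pi * R * ((4 * K * (1 + R) ^ α + ‖f 0‖) / R ^ 2) := by
    refine circleIntegral.norm_integral_le_of_norm_le_const hR.le fun z hz => ?_
    rw [mem_sphere_zero_iff_norm] at hz
    have hz0 : z ≠ 0 := fun h => by rw [h, norm_zero] at hz; linarith
    have hcos := exp_abs_le_norm_cos hN hz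
    have hcpos : 0 < ‖Complex.cos z‖ := lt_of_lt_of_le (by positivity) hcos
    have hc0 : Complex.cos z ≠ 0 := norm_pos_iff.1 hcpos
    simp only [hF]
    rw [hpne z hz0, norm_smul, norm_smul, norm_inv, norm_inv, norm_mul, hz]
    have hqn : ‖q z‖ ≤ (4 * K * (1 + R) ^ α + ‖f 0‖) * ‖Complex.cos z‖ := by
      calc ‖q z‖ ≤ ‖f z‖ + ‖Complex.cos z • f 0‖ := norm_sub_le _ _
        _ ≤ K * (1 + R) ^ α * Real.exp |z.im| + ‖Complex.cos z‖ * ‖f 0‖ := by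
            rw [norm_smul]; gcongr; rw [← hz]; exact hK z
        _ ≤ K * (1 + R) ^ α * (4 * ‖Complex.cos z‖) + ‖Complex.cos z‖ * ‖f 0‖ := by
            gcongr; linarith
        _ = _ := by ring
    calc _ ≤ (R * ‖Complex.cos z‖)⁻¹ *
          (R⁻¹ * ((4 * K * (1 + R) ^ α + ‖f 0‖) * ‖Complex.cos z‖)) := by gcongr
      _ = _ := by field_simp
  rw [hint, norm_smul] at hbound
  have hpi : ‖(2 * Real.pi * Complex.I : ℂ)‖ = 2 * Real.pi := by
    simp [abs_of_pos Real.pi_pos]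
  rw [hpi, mul_assoc (2 * Real.pi), mul_le_mul_iff_right₀ Real.two_pi_pos] at hbound
  have hres0 : res 0 = deriv f 0 := by simp [hres, hp0]
  have hresk : ∀ k, ‖res (cosZero k)‖ = ‖f (cosZero k)‖ / cosZero k ^ 2 := by
    intro k
    have hk : (cosZero k : ℂ) ≠ 0 := by exact_mod_cast cosZero_ne_zero k
    simp only [hres]
    rw [hpne _ hk, norm_smul, norm_smul, cos_cosZero, zero_sub, norm_inv, norm_neg, norm_mul,
      norm_sin_cosZero, mul_one, norm_inv, hq]
    simp only [cos_cosZero, zero_smul, sub_zero, Complex.norm_real, Real.norm_eq_abs]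
    rw [← sq_abs (cosZero k)]
    ring
  rw [hSdef, Finset.sum_insert h0S, hres0,
    Finset.sum_image (fun a _ b _ h => cosZero_injective (by exact_mod_cast h))] at hbound
  have hR2 : R * ((4 * K * (1 + R) ^ α + ‖f 0‖) / R ^ 2) = (4 * K * (1 + R) ^ α + ‖f 0‖) / R := by
    field_simp
  rw [hR2] at hbound
  calc ‖deriv f 0‖ = ‖(deriv f 0 + ∑ k ∈ Finset.Ico (-N : ℤ) N, res (cosZero k)) -
        ∑ k ∈ Finset.Ico (-N : ℤ) N, res (cosZero k)‖ := by rw [add_sub_cancel_right]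
    _ ≤ (4 * K * (1 + R) ^ α + ‖f 0‖) / R + ∑ k ∈ Finset.Ico (-N : ℤ) N, ‖res (cosZero k)‖ :=
        (norm_sub_le _ _).trans (add_le_add hbound (norm_sum_le _ _))
    _ = _ := by rw [add_comm]; simp only [hresk]

/-- The boundary term is of order `N^(α - 1) + N⁻¹`, so it vanishes as `N` grows because `α < 1`;
the growth constant `K` disappears with it. -/
theorem norm_deriv_zero_le_of_summable {E : Type*} [NormedAddCommGroup E] [NormedSpace ℂ E]
    [CompleteSpace E] {f : ℂ → E} (hf : Differentiable ℂ f) {K α : ℝ} (hα : α < 1) (hK0 : 0 ≤ K)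
    (hK : ∀ z, ‖f z‖ ≤ K * (1 + ‖z‖) ^ α * Real.exp |z.im|) {c : ℤ → ℝ}
    (hc : ∀ k, ‖f (cosZero k)‖ / cosZero k ^ 2 ≤ c k) (hsum : Summable c) :
    ‖deriv f 0‖ ≤ ∑' k, c k := by
  have hc0 : ∀ k, 0 ≤ c k := fun k => le_trans (by positivity) (hc k)
  have hlim : Tendsto (fun R : ℝ => (4 * K * (1 + R) ^ α + ‖f 0‖) / R) atTop (𝓝 0) := by
    have h1 : Tendsto (fun R : ℝ => (1 + R) ^ (α - 1)) atTop (𝓝 0) := by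
      have := (tendsto_rpow_neg_atTop (y := 1 - α) (by linarith)).comp
        (tendsto_atTop_add_const_left atTop (1 : ℝ) tendsto_id)
      simpa [Function.comp_def] using this
    have h2 : Tendsto (fun R : ℝ => (1 + R) / R) atTop (𝓝 1) := by
      have : Tendsto (fun R : ℝ => R⁻¹ + 1) atTop (𝓝 (0 + 1)) :=
        tendsto_inv_atTop_zero.add_const 1
      rw [zero_add] at this
      refine this.congr' ?_
      filter_upwards [eventually_gt_atTop 0] with R hR
      field_simp
    have h3 := ((h1.mul h2).const_mul (4 * K)).add (tendsto_inv_atTop_zero.const_mul ‖f 0‖)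
    simp only [zero_mul, mul_zero, add_zero] at h3
    refine h3.congr' ?_
    filter_upwards [eventually_gt_atTop 0] with R hR
    rw [Real.rpow_sub (by linarith), Real.rpow_one]
    have : 1 + R ≠ 0 := by positivity
    field_simp
  have hN : Tendsto (fun N : ℕ => (N : ℝ) * Real.pi) atTop atTop :=
    tendsto_natCast_atTop_atTop.atTop_mul_const Real.pi_pos
  have h := (hlim.comp hN).const_add (∑' k, c k)
  rw [add_zero] at h
  refine ge_of_tendsto h ?_
  filter_upwards [eventually_ge_atTop 1] with N hN
  refine (norm_deriv_zero_le_finset_sum hf hK0 hK hN).trans ?_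
  refine add_le_add_left ?_ _
  exact (Finset.sum_le_sum fun k _ => hc k).trans (hsum.sum_le_tsum _ fun k _ => hc0 k)

/-- Removing the even terms from `ζ(2) = π²/6` leaves `π²/8`, and the odd integers of both signs
give `π²/4`. This makes the coefficient of `ρ` in Bernstein's inequality equal to 1. -/
theorem commutatorConst_zero : commutatorConst 0 = 1 := by
  have hz := hasSum_zeta_two
  have hev : HasSum (fun n : ℕ => 1 / ((2 * n : ℕ) : ℝ) ^ 2) (Real.pi ^ 2 / 6 / 4) := by
    refine HasSum.congr_fun (hz.div_const 4) fun n => ?_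
    push_cast
    rw [mul_pow, div_div, mul_comm]
    norm_num
  have hinj : Function.Injective fun n : ℕ => 2 * n + 1 := fun a b h => by simpa using h
  have hodd : HasSum (fun n : ℕ => 1 / ((2 * n + 1 : ℕ) : ℝ) ^ 2) (Real.pi ^ 2 / 8) := by
    have hs : Summable (fun n : ℕ => 1 / ((2 * n + 1 : ℕ) : ℝ) ^ 2) := hz.summable.comp_injective hinj
    have h := (HasSum.even_add_odd (f := fun n : ℕ => 1 / (n : ℝ) ^ 2) hev hs.hasSum).unique hz
    rw [show Real.pi ^ 2 / 8 = ∑' n : ℕ, 1 / ((2 * n + 1 : ℕ) : ℝ) ^ 2 by linarith]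
    exact hs.hasSum
  have hint : HasSum (fun k : ℤ => 1 / |2 * (k : ℝ) + 1| ^ ((2 : ℝ) - 0))
      (Real.pi ^ 2 / 8 + Real.pi ^ 2 / 8) := by
    refine HasSum.of_nat_of_neg_add_one ?_ ?_
    · refine HasSum.congr_fun hodd fun n => ?_
      rw [sub_zero, Real.rpow_two, sq_abs]
      push_cast
      rfl
    · refine HasSum.congr_fun hodd fun n => ?_
      rw [sub_zero, Real.rpow_two, sq_abs]
      push_cast
      congr 1
      ring
  rw [commutatorConst, hint.tsum_eq]
  have := Real.pi_ne_zero
  rw [sub_zero, Real.rpow_two]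
  field_simp
  norm_num

/-- Bernstein's inequality for entire functions of exponential type with sublinear growth on the
real line. -/
theorem norm_deriv_zero_le_commutatorConst {E : Type*} [NormedAddCommGroup E] [NormedSpace ℂ E]
    [CompleteSpace E] {f : ℂ → E} (hf : Differentiable ℂ f) {M C ρ α : ℝ} (hα₀ : 0 ≤ α)
    (hα₁ : α < 1) (hρ : 0 < ρ) (hC : 0 ≤ C) (hM : ∀ z, ‖f z‖ ≤ M * Real.exp (ρ * ‖z‖))
    (hreal : ∀ t : ℝ, ‖f t‖ ≤ C * (1 + |t| ^ α)) :
    ‖deriv f 0‖ ≤ C * (ρ + commutatorConst α * ρ ^ (1 - α)) := by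
  -- Rescaling to type 1 turns `|t|^α` into `ρ^(-α) |t|^α`; undoing it multiplies by `ρ`, whence
  -- `ρ^(1 - α)`.
  set h : ℂ → E := fun z => f ((ρ : ℂ)⁻¹ * z) with hh
  have hρ' : (ρ : ℂ) ≠ 0 := by exact_mod_cast hρ.ne'
  have hd : Differentiable ℂ h := hf.comp (by fun_prop)
  have hderiv : deriv h 0 = (ρ : ℂ)⁻¹ • deriv f 0 := by
    rw [hh, deriv_comp_mul_left]; simp
  have hreal' : ∀ t : ℝ, ‖h t‖ ≤ C * (1 + ρ ^ (-α) * |t| ^ α) := by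
    intro t
    have h1 := hreal (ρ⁻¹ * t)
    rw [abs_mul, abs_of_pos (inv_pos.2 hρ), Real.mul_rpow (inv_pos.2 hρ).le (abs_nonneg _),
      Real.inv_rpow hρ.le, ← Real.rpow_neg hρ.le] at h1
    simpa [hh] using h1
  have hK : ∀ t : ℝ, ‖h t‖ ≤ C * (1 + ρ ^ (-α)) * ‖(1 - Complex.I * t : ℂ)‖ ^ α := by
    intro t
    have hn1 : 1 ≤ ‖(1 - Complex.I * t : ℂ)‖ := by
      refine le_trans ?_ (Complex.re_le_norm _)
      simp
    have hn2 : |t| ≤ ‖(1 - Complex.I * t : ℂ)‖ := by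
      refine le_trans (le_of_eq ?_) (Complex.abs_im_le_norm _)
      simp
    refine (hreal' t).trans ?_
    rw [mul_assoc, add_mul, one_mul]
    gcongr
    exact Real.one_le_rpow hn1 hα₀
  have hgrowth := norm_le_mul_exp_abs_im hd hα₀ (M := M) (fun z => by
    have := hM ((ρ : ℂ)⁻¹ * z)
    rwa [norm_mul, norm_inv, Complex.norm_real, Real.norm_of_nonneg hρ.le,
      mul_inv_cancel_left₀ hρ.ne'] at this) hK
  have hsum : ∀ β : ℝ, β < 1 →
      HasSum (fun k : ℤ => |cosZero k| ^ β / cosZero k ^ 2) (commutatorConst β) := by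
    intro β hβ
    refine HasSum.congr_fun ((summable_commutatorConst hβ).hasSum.mul_left ((2 / Real.pi) ^ (2 - β))) fun k => ?_
    have hk : 0 < |cosZero k| := abs_pos.2 (cosZero_ne_zero k)
    have hk' : |2 * (k : ℝ) + 1| = (2 / Real.pi) * |cosZero k| := by
      have hpi := Real.pi_pos
      rw [cosZero, mul_div_assoc, abs_mul, abs_of_pos (by positivity : 0 < Real.pi / 2)]
      field_simp
    rw [hk', Real.mul_rpow (by positivity) hk.le, ← sq_abs, ← Real.rpow_two, ← Real.rpow_sub hk,
      show β - 2 = -(2 - β) by ring, Real.rpow_neg hk.le]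
    have : (2 / Real.pi) ^ (2 - β) ≠ 0 := (Real.rpow_pos_of_pos (by positivity) _).ne'
    field_simp
  have hs := ((hsum 0 one_pos).add ((hsum α hα₁).mul_left (ρ ^ (-α)))).mul_left C
  have hmain := norm_deriv_zero_le_of_summable hd hα₁ (by positivity) hgrowth
    (c := fun k => C * (|cosZero k| ^ (0 : ℝ) / cosZero k ^ 2 +
      ρ ^ (-α) * (|cosZero k| ^ α / cosZero k ^ 2))) (fun k => by
        rw [Real.rpow_zero, ← mul_div_assoc, ← add_div, ← mul_div_assoc]
        gcongr
        exact hreal' _) hs.summable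
  rw [hs.tsum_eq, hderiv, norm_smul, norm_inv, Complex.norm_real, Real.norm_of_nonneg hρ.le,
    inv_mul_le_iff₀ hρ, commutatorConst_zero] at hmain
  refine hmain.trans (le_of_eq ?_)
  rw [sub_eq_add_neg, Real.rpow_add hρ, Real.rpow_one]
  ring

/-! ### Local resolvents and the growth of powers -/

variable {Y : Type*} [NormedAddCommGroup Y] [NormedSpace ℂ Y]

/-- The difference `d` of two solutions satisfies `d = w D d`. For `w ≠ 0` the substitution `z =
w⁻¹` gives `z d = D d`, to which SVEP applies; at `w = 0` the equation itself forces `d = 0`. -/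
theorem HasSVEP.eqOn_of_sub_smul_eq {D : Y →L[ℂ] Y} (hD : HasSVEP D) {y : Y} {V : Set ℂ}
    (hV : IsOpen V) {v₁ v₂ : ℂ → Y} (h₁ : AnalyticOnNhd ℂ v₁ V) (h₂ : AnalyticOnNhd ℂ v₂ V)
    (e₁ : ∀ w ∈ V, v₁ w - w • D (v₁ w) = y) (e₂ : ∀ w ∈ V, v₂ w - w • D (v₂ w) = y) :
    Set.EqOn v₁ v₂ V := by
  have hdiff : ∀ w ∈ V, v₁ w - v₂ w = w • D (v₁ w - v₂ w) := by
    intro w hw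
    have := (e₁ w hw).trans (e₂ w hw).symm
    rw [map_sub, smul_sub]
    rw [sub_eq_sub_iff_add_eq_add] at this ⊢
    rw [this]; abel
  intro w hw
  rw [← sub_eq_zero]
  by_cases hw0 : w = 0
  · rw [hdiff w hw, hw0, zero_smul]
  · set U : Set ℂ := {0}ᶜ ∩ (fun z => z⁻¹) ⁻¹' V with hU
    have hUo : IsOpen U :=
      (continuousOn_inv₀ (G₀ := ℂ)).isOpen_inter_preimage isOpen_compl_singleton hV
    have := hD U hUo (fun z => v₁ z⁻¹ - v₂ z⁻¹) ?_ ?_ w⁻¹ ⟨by simpa using hw0, by simpa using hw⟩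
    · simpa using this
    · intro z hz
      have hi : AnalyticAt ℂ (fun z : ℂ => z⁻¹) z := analyticAt_inv hz.1
      exact ((h₁ _ hz.2).fun_comp hi).sub ((h₂ _ hz.2).fun_comp hi)
    · intro z hz
      have hz0 : z ≠ 0 := hz.1
      have h := congrArg (z • ·) (hdiff _ hz.2)
      simp only [smul_inv_smul₀ hz0] at h
      exact sub_eq_zero.2 h

/-- If `u` solves the resolvent equation near `w⁻¹`, then `s⁻¹ • u s⁻¹` solves this one near `w`. At
`w = 0`, the point at infinity for the resolvent, `1 - s • D` is invertible nearby. -/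
theorem exists_local_solution [CompleteSpace Y] (D : Y →L[ℂ] Y) {y : Y} {w : ℂ}
    (h : w ≠ 0 → w⁻¹ ∈ localResolventSet D y) :
    ∃ V : Set ℂ, IsOpen V ∧ w ∈ V ∧ ∃ v : ℂ → Y, AnalyticOnNhd ℂ v V ∧
      ∀ s ∈ V, v s - s • D (v s) = y := by
  by_cases hw : w = 0
  · subst hw
    set V : Set ℂ := {s | IsUnit (1 - s • D)} with hV
    have hVo : IsOpen V := Units.isOpen.preimage (f := fun s : ℂ => 1 - s • D) (by fun_prop)
    refine ⟨V, hVo, by simp [hV], fun s => Ring.inverse (1 - s • D) y, ?_, ?_⟩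
    · refine DifferentiableOn.analyticOnNhd (fun s hs => ?_) hVo
      obtain ⟨x, hx⟩ := hs
      have h1 : DifferentiableAt ℂ (Ring.inverse : (Y →L[ℂ] Y) → _) (1 - s • D) := by
        rw [← hx]; exact differentiableAt_inverse x.isUnit
      have h3 : DifferentiableAt ℂ (fun s : ℂ => 1 - s • D) s :=
        (differentiableAt_const _).sub (DifferentiableAt.smul_const differentiableAt_id D)
      have h2 : DifferentiableAt ℂ (fun s : ℂ => Ring.inverse (1 - s • D)) s :=
        DifferentiableAt.fun_comp' s h1 h3
      exact (h2.clm_apply (differentiableAt_const y)).differentiableWithinAt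
    · intro s hs
      have h := congrArg (fun S : Y →L[ℂ] Y => S y) (Ring.mul_inverse_cancel _ hs)
      simpa using h
  · obtain ⟨U, hU, hwU, u, hu, he⟩ := h hw
    refine ⟨{0}ᶜ ∩ (fun z => z⁻¹) ⁻¹' U,
      (continuousOn_inv₀ (G₀ := ℂ)).isOpen_inter_preimage isOpen_compl_singleton hU,
      ⟨hw, hwU⟩, fun s => s⁻¹ • u s⁻¹, ?_, ?_⟩
    · intro s hs
      have hi : AnalyticAt ℂ (fun z : ℂ => z⁻¹) s := analyticAt_inv hs.1
      exact hi.smul ((hu _ hs.2).fun_comp hi)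
    · intro s hs
      have hs0 : s ≠ 0 := hs.1
      rw [map_smul, smul_inv_smul₀ hs0]
      exact he _ hs.2

theorem HasSVEP.exists_global_solution [CompleteSpace Y] {D : Y →L[ℂ] Y} (hD : HasSVEP D) {y : Y}
    {ρ : ℝ} (hρ : 0 < ρ) (h : ∀ z : ℂ, ρ ≤ ‖z‖ → z ∈ localResolventSet D y) :
    ∃ g : ℂ → Y, DifferentiableOn ℂ g (closedBall 0 ρ⁻¹) ∧
      ∀ w ∈ closedBall (0 : ℂ) ρ⁻¹, g w - w • D (g w) = y := by
  have hloc : ∀ w : closedBall (0 : ℂ) ρ⁻¹, ∃ V : Set ℂ, IsOpen V ∧ (w : ℂ) ∈ V ∧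
      ∃ v : ℂ → Y, AnalyticOnNhd ℂ v V ∧ ∀ s ∈ V, v s - s • D (v s) = y := by
    rintro ⟨w, hw⟩
    refine exists_local_solution D fun hw0 => h _ ?_
    rw [mem_closedBall_zero_iff] at hw
    rw [norm_inv]
    exact (le_inv_comm₀ hρ (norm_pos_iff.2 hw0)).2 hw
  choose V hVo hwV v hv he using hloc
  classical
  -- Each point uses the local solution chosen for that point; uniqueness on overlaps makes `g`
  -- agree with each local solution on its neighbourhood within the disc.
  set g : ℂ → Y := fun w => if hw : w ∈ closedBall (0 : ℂ) ρ⁻¹ then v ⟨w, hw⟩ w else 0 with hg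
  have hgv : ∀ w : closedBall (0 : ℂ) ρ⁻¹, ∀ s ∈ closedBall (0 : ℂ) ρ⁻¹, s ∈ V w →
      g s = v w s := by
    intro w s hs hsV
    rw [hg]
    simp only [hs, dif_pos]
    exact hD.eqOn_of_sub_smul_eq ((hVo ⟨s, hs⟩).inter (hVo w))
      ((hv ⟨s, hs⟩).mono Set.inter_subset_left) ((hv w).mono Set.inter_subset_right)
      (fun s' h' => he _ _ h'.1) (fun s' h' => he _ _ h'.2) ⟨hwV ⟨s, hs⟩, hsV⟩
  refine ⟨g, fun w hw => ?_, fun w hw => ?_⟩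
  · refine ((hv ⟨w, hw⟩ w (hwV ⟨w, hw⟩)).differentiableAt.differentiableWithinAt).congr_of_eventuallyEq
      ?_ (hgv ⟨w, hw⟩ w hw (hwV ⟨w, hw⟩))
    filter_upwards [self_mem_nhdsWithin,
      nhdsWithin_le_nhds ((hVo ⟨w, hw⟩).mem_nhds (hwV ⟨w, hw⟩))] with s hs hsV
    exact hgv _ s hs hsV
  · rw [hgv ⟨w, hw⟩ w hw (hwV ⟨w, hw⟩)]
    exact he ⟨w, hw⟩ w (hwV ⟨w, hw⟩)

/-- Formally `g w = ∑ w^n D^n y`. Substituting `g = y + w D g` under the integral raises the power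
of `D` by one, since the term with `y` integrates to zero. -/
theorem circleIntegral_eq_pow_apply [CompleteSpace Y] {D : Y →L[ℂ] Y} {y : Y} {R : ℝ} (hR : 0 < R)
    {g : ℂ → Y} (hg : DifferentiableOn ℂ g (closedBall 0 R))
    (he : ∀ w ∈ closedBall (0 : ℂ) R, g w - w • D (g w) = y) (n : ℕ) :
    ∮ w in C(0, R), (w ^ (n + 1))⁻¹ • g w = (2 * Real.pi * Complex.I : ℂ) • (D ^ n) y := by
  have hne : ∀ w ∈ sphere (0 : ℂ) R, w ≠ 0 := fun w hw h => by
    rw [mem_sphere_zero_iff_norm, h, norm_zero] at hw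
    linarith
  have hpow : ∀ n : ℕ, ContinuousOn (fun w : ℂ => (w ^ n)⁻¹) (sphere 0 R) := fun n =>
    ContinuousOn.inv₀ (by fun_prop) fun w hw => pow_ne_zero _ (hne w hw)
  have hgc : ContinuousOn g (sphere 0 R) := hg.continuousOn.mono sphere_subset_closedBall
  induction n with
  | zero =>
    have h := hg.circleIntegral_sub_inv_smul (mem_ball_self hR)
    have h0 : g 0 = y := by simpa using he 0 (mem_closedBall_self hR.le)
    simpa [h0] using h
  | succ n ih =>
    have hci : CircleIntegrable (fun w => (w ^ (n + 1))⁻¹ • g w) 0 R :=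
      ((hpow _).smul hgc).circleIntegrable hR.le
    have h1 : ∮ w in C(0, R), (w ^ (n + 1 + 1))⁻¹ • g w =
        ∮ w in C(0, R), ((w ^ (n + 1 + 1))⁻¹ • y + D ((w ^ (n + 1))⁻¹ • g w)) := by
      refine circleIntegral.integral_congr hR.le fun w hw => ?_
      have hw0 := hne w hw
      have h2 := sub_eq_iff_eq_add.1 (he w (sphere_subset_closedBall hw))
      conv_lhs => rw [h2]
      rw [smul_add, smul_smul, map_smul]
      congr 2
      field_simp
      ring
    have h2 : ∮ w in C(0, R), (w ^ (n + 1 + 1))⁻¹ = 0 := by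
      have := circleIntegral.integral_sub_zpow_of_ne (n := -(n + 1 + 1 : ℕ)) (by omega) 0 0 R
      simpa only [sub_zero, zpow_neg, zpow_natCast] using this
    have h3 : ∮ w in C(0, R), D ((w ^ (n + 1))⁻¹ • g w) =
        D (∮ w in C(0, R), (w ^ (n + 1))⁻¹ • g w) := by
      simp only [circleIntegral]
      rw [← ContinuousLinearMap.intervalIntegral_comp_comm _ hci.out]
      simp only [map_smul]
    have h4 : CircleIntegrable (fun w : ℂ => (w ^ (n + 1 + 1))⁻¹ • y) 0 R :=
      ((hpow _).smul continuousOn_const).circleIntegrable hR.le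
    have h5 : CircleIntegrable (fun w : ℂ => D ((w ^ (n + 1))⁻¹ • g w)) 0 R :=
      (D.continuous.comp_continuousOn ((hpow _).smul hgc)).circleIntegrable hR.le
    rw [h1, circleIntegral.integral_add h4 h5,
      circleIntegral.integral_smul_const, h2, zero_smul, zero_add, h3, ih, map_smul, pow_succ']
    rfl

/-- Under SVEP the powers of `D` at `y` grow no faster than the local spectral radius allows. -/
theorem HasSVEP.exists_norm_pow_apply_le [CompleteSpace Y] {D : Y →L[ℂ] Y} (hD : HasSVEP D) {y : Y}
    {ρ : ℝ} (hρ : localSpectralRadius D y < ρ) : ∃ M : ℝ, ∀ n : ℕ, ‖(D ^ n) y‖ ≤ M * ρ ^ n := by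
  have hr0 : 0 ≤ localSpectralRadius D y := Real.sSup_nonneg (by rintro _ ⟨z, -, rfl⟩; positivity)
  have hρ0 : 0 < ρ := hr0.trans_lt hρ
  have hR : 0 < ρ⁻¹ := inv_pos.2 hρ0
  obtain ⟨g, hg, he⟩ := hD.exists_global_solution (y := y) hρ0 fun z hz => by
    by_contra hn
    have : ‖z‖ ≤ localSpectralRadius D y :=
      le_csSup (bddAbove_norm_localSpectrum D y) ⟨z, hn, rfl⟩
    linarith
  obtain ⟨B, hB⟩ := (isCompact_closedBall (0 : ℂ) ρ⁻¹).exists_bound_of_continuousOn hg.continuousOn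
  refine ⟨B, fun n => ?_⟩
  have hle : ‖∮ w in C(0, ρ⁻¹), (w ^ (n + 1))⁻¹ • g w‖ ≤ 2 * Real.pi * ρ⁻¹ * (ρ ^ (n + 1) * B) := by
    refine circleIntegral.norm_integral_le_of_norm_le_const hR.le fun w hw => ?_
    have hw' := mem_sphere_zero_iff_norm.1 hw
    rw [norm_smul, norm_inv, norm_pow, hw', inv_pow, inv_inv]
    gcongr
    exact hB w (sphere_subset_closedBall hw)
  rw [circleIntegral_eq_pow_apply hR hg he, norm_smul,
    show ‖(2 * Real.pi * Complex.I : ℂ)‖ = 2 * Real.pi by simp [abs_of_pos Real.pi_pos],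
    mul_assoc (2 * Real.pi), mul_le_mul_iff_right₀ Real.two_pi_pos] at hle
  refine hle.trans (le_of_eq ?_)
  rw [pow_succ]
  field_simp

/-! ### The orbit of conjugation and its exponential type -/

theorem norm_le_exp_of_hasDerivAt [CompleteSpace Y] {D : Y →L[ℂ] Y} {f : ℂ → Y}
    (hf : ∀ z, HasDerivAt f (D (f z)) z) {M ρ : ℝ} (hM : ∀ n : ℕ, ‖(D ^ n) (f 0)‖ ≤ M * ρ ^ n)
    (z : ℂ) : ‖f z‖ ≤ M * Real.exp (ρ * ‖z‖) := by
  have hit : ∀ n, iteratedDeriv n f = fun z => (D ^ n) (f z) := by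
    intro n
    induction n with
    | zero => simp
    | succ n ih =>
      rw [iteratedDeriv_succ, ih]
      funext z
      have := ((D ^ n).hasFDerivAt.comp_hasDerivAt z (hf z)).deriv
      rw [pow_succ]
      exact this
  have hs := Complex.hasSum_taylorSeries_of_entire (fun z => (hf z).differentiableAt) 0 z
  have he := (NormedSpace.expSeries_div_hasSum_exp (ρ * ‖z‖)).mul_left M
  rw [← Real.exp_eq_exp_ℝ] at he
  refine hs.norm_le_of_bounded he fun n => ?_
  rw [hit, norm_smul, norm_smul, sub_zero, norm_inv, norm_pow, Complex.norm_natCast, mul_pow]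
  calc _ ≤ (n.factorial : ℝ)⁻¹ * (‖z‖ ^ n * (M * ρ ^ n)) := by gcongr; exact hM n
    _ = _ := by ring

theorem hasDerivAt_exp_mul_mul_exp_neg {X : Type*} [NormedAddCommGroup X] [NormedSpace ℂ X]
    [CompleteSpace X] (A T : X →L[ℂ] X) (z : ℂ) :
    HasDerivAt (fun z : ℂ => NormedSpace.exp (z • A) * T * NormedSpace.exp (-(z • A)))
      (innerDerivation A (NormedSpace.exp (z • A) * T * NormedSpace.exp (-(z • A)))) z := by
  have h1 := hasDerivAt_exp_smul_const' A z
  have h2 := hasDerivAt_exp_smul_const (-A) z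
  simp only [smul_neg] at h2
  refine ((h1.mul_const T).mul h2).congr_deriv ?_
  rw [innerDerivation_apply]
  simp only [mul_assoc, mul_neg]
  abel

end LocalSpectral

theorem corollary4p3 {X : Type*} [NormedAddCommGroup X] [NormedSpace ℂ X] [CompleteSpace X]
    (A T : X →L[ℂ] X) (hA : LocalSpectral.HasSVEP (LocalSpectral.innerDerivation A))
    (α : ℝ) (hα₀ : 0 ≤ α) (hα₁ : α < 1) (C_T : ℝ) (hC : 0 < C_T)
    (hT : ∀ t : ℝ, ‖NormedSpace.exp ((t : ℂ) • A) * T * NormedSpace.exp (-((t : ℂ) • A))‖ ≤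
      C_T * (1 + |t| ^ α)) :
    ‖A * T - T * A‖ ≤
      C_T * (LocalSpectral.localSpectralRadius (LocalSpectral.innerDerivation A) T +
        LocalSpectral.commutatorConst α *
          LocalSpectral.localSpectralRadius (LocalSpectral.innerDerivation A) T ^ (1 - α)) := by
  set r := LocalSpectral.localSpectralRadius (LocalSpectral.innerDerivation A) T with hr
  have hr0 : 0 ≤ r := Real.sSup_nonneg (by rintro _ ⟨z, -, rfl⟩; positivity)
  -- The growth bound is available only for `ρ > r`, so `ρ` tends to `r` from the right. Continuity
  -- holds even at `r = 0` because `1 - α > 0`.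
  have hcont : ContinuousAt
      (fun ρ : ℝ => C_T * (ρ + LocalSpectral.commutatorConst α * ρ ^ (1 - α))) r :=
    continuousAt_const.mul (continuousAt_id.add (continuousAt_const.mul
      (Real.continuousAt_rpow_const _ _ (Or.inr (by linarith)))))
  refine ge_of_tendsto (hcont.tendsto.mono_left (nhdsWithin_le_nhds (s := Set.Ioi r))) ?_
  filter_upwards [self_mem_nhdsWithin] with ρ hρ
  have hf := LocalSpectral.hasDerivAt_exp_mul_mul_exp_neg A T
  obtain ⟨M, hM⟩ := hA.exists_norm_pow_apply_le hρ
  have h0 : NormedSpace.exp ((0 : ℂ) • A) * T * NormedSpace.exp (-((0 : ℂ) • A)) = T := by simp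
  have hbd := LocalSpectral.norm_deriv_zero_le_commutatorConst (fun z => (hf z).differentiableAt)
    hα₀ hα₁ (hr0.trans_lt hρ) hC.le
    (LocalSpectral.norm_le_exp_of_hasDerivAt hf fun n => by
      rw [h0]; exact hM n) hT
  rw [(hf 0).deriv, h0] at hbd
  exact hbd
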